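/- Let $\mathbb L=[0,\infty]$, with infima taken for the usual order, and let $\mathcal M(X)$ (also written $!X$) be the set of finite multisets over a set $X$. For disjoint unions $X+Y$, write $\mu\oplus\rho\in\,!(X+Y)$ for the multiset corresponding to $(\mu,\rho)\in\,!X\times!Y$. **The model.** A morphism $X\to Y$ of the tropical relational model is a matrix $f\in\mathbb L^{!X\times Y}$. Composition is $$(g\circ f)_{\chi,c}=\inf\Big\{g_{[b_1,\dots,b_n],c}+\sum_{i=1}^n f_{\chi_i,b_i}\ \Big|\ n\in\mathbb N,\ b_i\in Y,\ \chi=\chi_1+\dots+\chi_n\Big\},$$ (that is, the coKleisli composition of the finite multiset comonad on $\mathbb L$-valued matrices), and the identity is $0$ at $([a],a)$ and $\infty$ elsewhere. The product of $X$ and $Y$ is $X+Y$, with $(\pi_1)_{\mu,a}=0$ if $\mu=[a]$ and $\infty$ otherwise (similarly $\pi_2$), and $\langle f,g\rangle_{\mu,-}$ is $f_{\mu,-}$ on $X$ and $g_{\mu,-}$ on $Y$. The exponential of $X$ and $Y$ is $!X\times Y$, with $\mathsf{ev}_{\mu,y}=0$ if $\mu=[(\rho,y)]\oplus\rho$ for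 some $\rho\in\,!X$ and $\infty$ otherwise, currying $(\Lambda f)_{\mu,(\nu,y)}=f_{\mu\oplus\nu,y}$, and $\Lambda^-f=\mathsf{ev}\circ\langle f\circ\pi_1,\pi_2\rangle$. The zero morphism is the constant matrix $\infty$ and the sum of morphisms is the pointwise minimum. For $f:X\to Y$ the differential $Df:X+X\to Y$ is $(Df)_{\mu\oplus\rho,b}=f_{\rho+\mu,b}$ if $\mu$ has exactly one element and $\infty$ otherwise; for $f:Z+X\to Y$ and $g:Z\to X$ put $f\star g=Df\circ\langle\langle\infty,g\circ\pi_1\rangle,\mathrm{id}\rangle:Z+X\to Y$. **The calculi.** Simple types are generated from ground types by $A\to B$. Besides the simply typed $\lambda$-terms $\Gamma\vdash M:A$, consider the terms of the simply typed differential $\lambda$-calculus, built from variables, $\lambda x.t$, application $tT$, differential application $\mathsf D[t,u]:A\to B$ (for $t:A\to B$ and $u:A$), $0:A$ and sums, modulo the equations saying that $+,0$ is an idempotent commutative monoid, that $\lambda x.(\_)$, $\mathsf D[\_,\_]$ (in both arguments) and $(\_)T$ are linear, and that $\mathsf D[\mathsf D[t,u],u']=\mathsf D[\mathsf D[t,u'],u]$.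 **Interpretation.** Fix an arbitrary set for each ground type; put $[\![A\to B]\!]=\,![\![A]\!]\times[\![B]\!]$ and let $[\![\Gamma]\!]$ be the disjoint union of the $[\![A_i]\!]$ for the types $A_i$ declared in $\Gamma$. A judgement $\Gamma\vdash t:A$ of either calculus is interpreted as a morphism $[\![\Gamma]\!]\to[\![A]\!]$: variables are projections, $[\![\lambda x.t]\!]=\Lambda[\![t]\!]$, $[\![tT]\!]=\mathsf{ev}\circ\langle[\![t]\!],[\![T]\!]\rangle$, and, in the differential calculus, $[\![\mathsf D[t,u]]\!]=\Lambda((\Lambda^-[\![t]\!])\star[\![u]\!])$, $[\![0]\!]=\infty$, $[\![t+u]\!]=\min\{[\![t]\!],[\![u]\!]\}$; this is compatible with the equations. **Taylor expansion.** The set $\mathcal T(M)$ of differential terms of the type of $M$, in the same context, is defined by $\mathcal T(x)=\{x\}$, $\mathcal T(\lambda x.M)=\{\lambda x.t\mid t\in\mathcal T(M)\}$ and $$\mathcal T(MN)=\{\mathsf D[\dots\mathsf D[\mathsf D[t,u_1],u_2]\dots,u_k]\,0\mid k\in\mathbb N,\ t\in\mathcal T(M),\ u_1,\dots,u_k\in\mathcal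 T(N)\}.$$ **Statement.** For every simply typed $\lambda$-term $\Gamma\vdash M:A$, $$[\![\Gamma\vdash M:A]\!]=\inf_{t\in\mathcal T(M)}[\![\Gamma\vdash t:A]\!],$$ where the infimum is taken pointwise in $\mathbb L^{![\![\Gamma]\!]\times[\![A]\!]}$. -/

import Mathlib

open scoped ENNReal

universe u v w

noncomputable section

namespace TropLam

/-! ### Matrices with coefficients in the Lawvere quantale `[0,∞]`

The tropical semiring has `inf` as addition (with zero `∞`) and `+` as multiplication
(with unit `0`). -/

/-- `Mat X Y` is the set of `[0,∞]`-valued matrices indexed by `X × Y`. As a function space it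
carries the pointwise order of `[0,∞]`; `⊤` is the matrix constantly equal to `∞`, which is the
zero morphism, and `⊓` (pointwise minimum) is the sum of morphisms. -/
abbrev Mat (X : Type u) (Y : Type v) : Type (max u v) := X → Y → ℝ≥0∞

open Classical in
/-- The tropical truth value of a proposition: `0` if it holds, `∞` otherwise. -/
def truth (p : Prop) : ℝ≥0∞ := if p then 0 else ⊤

/-- Composition `s t` of matrices: `(s t)_{a,c} = inf_b (s_{b,c} + t_{a,b})`. -/
def Mat.comp {X : Type u} {Y : Type v} {Z : Type w} (s : Mat Y Z) (t : Mat X Y) : Mat X Z :=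
  fun a c => ⨅ b : Y, s b c + t a b

/-! ### The finite multiset comonad `!` and its coKleisli category -/

/-- The action of `!` on a matrix `f`: the entry at `([x₁,…,xₖ], [y₁,…,yₖ])` is the minimum over
all pairings (multisets `γ` of pairs with the prescribed marginals) of the sum of the
`f_{x,y}`; it is `∞` if the two multisets have different cardinalities. -/
def Mat.bang {X : Type u} {Y : Type v} (f : Mat X Y) : Mat (Multiset X) (Multiset Y) :=
  fun α β => ⨅ γ : {γ : Multiset (X × Y) // γ.map Prod.fst = α ∧ γ.map Prod.snd = β},
    (γ.1.map fun p => f p.1 p.2).sum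

/-- Dereliction, the counit of `!`. -/
def der (X : Type u) : Mat (Multiset X) X := fun μ a => truth (μ = {a})

/-- Digging, the comultiplication of `!`. -/
def dig (X : Type u) : Mat (Multiset X) (Multiset (Multiset X)) := fun μ B => truth (μ = B.sum)

/-- Morphisms `X → Y` of the coKleisli category. -/
abbrev Hom (X : Type u) (Y : Type v) : Type (max u v) := Mat (Multiset X) Y

/-- CoKleisli composition `s ∘! t`. -/
def Hom.comp {X : Type u} {Y : Type v} {Z : Type w} (s : Hom Y Z) (t : Hom X Y) : Hom X Z :=
  Mat.comp s (Mat.comp (Mat.bang t) (dig X))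

/-- The identity of the coKleisli category. -/
def Hom.id (X : Type u) : Hom X X := der X

/-! ### Cartesian closed structure: the product is `X ⊕ Y`, the exponential `!X × Y` -/

/-- First projection. -/
def Hom.fst (X : Type u) (Y : Type v) : Hom (X ⊕ Y) X := fun μ a => truth (μ = {Sum.inl a})

/-- Second projection. -/
def Hom.snd (X : Type u) (Y : Type v) : Hom (X ⊕ Y) Y := fun μ b => truth (μ = {Sum.inr b})

/-- Pairing. -/
def Hom.pair {Z : Type w} {X : Type u} {Y : Type v} (f : Hom Z X) (g : Hom Z Y) :
    Hom Z (X ⊕ Y) :=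
  fun μ => Sum.elim (f μ) (g μ)

/-- The bijection `(μ, ρ) ↦ μ ⊕ ρ` from `!X × !Y` to `!(X ⊕ Y)`. -/
def oplus {X : Type u} {Y : Type v} (μ : Multiset X) (ρ : Multiset Y) : Multiset (X ⊕ Y) :=
  μ.map Sum.inl + ρ.map Sum.inr

/-- The first component of the inverse of `oplus`. -/
def lefts {X : Type u} {Y : Type v} (χ : Multiset (X ⊕ Y)) : Multiset X :=
  χ.filterMap Sum.getLeft?

/-- The second component of the inverse of `oplus`. -/
def rights {X : Type u} {Y : Type v} (χ : Multiset (X ⊕ Y)) : Multiset Y :=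
  χ.filterMap Sum.getRight?

/-- Evaluation. -/
def Hom.ev (X : Type u) (Y : Type v) : Hom ((Multiset X × Y) ⊕ X) Y :=
  fun μ y => truth (∃ ρ : Multiset X, μ = oplus {(ρ, y)} ρ)

/-- Currying. -/
def Hom.curry {Z : Type w} {X : Type u} {Y : Type v} (f : Hom (Z ⊕ X) Y) :
    Hom Z (Multiset X × Y) :=
  fun μ p => f (oplus μ p.1) p.2

/-- Uncurrying `Λ⁻ f = ev ∘! (f × id)`. -/
def Hom.uncurry {Z : Type w} {X : Type u} {Y : Type v} (f : Hom Z (Multiset X × Y)) :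
    Hom (Z ⊕ X) Y :=
  (Hom.ev X Y).comp (Hom.pair (f.comp (Hom.fst Z X)) (Hom.snd Z X))

/-! ### Differential structure -/

open Classical in
/-- The differential operator: `(D t)_{μ⊕ρ,b} = t_{ρ+μ,b}` if `#μ = 1`, and `∞` otherwise. -/
def Hom.diff {X : Type u} {Y : Type v} (t : Hom X Y) : Hom (X ⊕ X) Y :=
  fun χ b => if Multiset.card (lefts χ) = 1 then t (rights χ + lefts χ) b else ⊤

/-- `f ⋆ g = (D f) ∘! ⟨⟨∞, g ∘! π₁⟩, id⟩`: differentiate `f` in its second component and apply the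
derivative to `g`. -/
def Hom.star {Z : Type u} {X : Type v} {Y : Type w} (f : Hom (Z ⊕ X) Y) (g : Hom Z X) :
    Hom (Z ⊕ X) Y :=
  (Hom.diff f).comp
    (Hom.pair (Hom.pair (⊤ : Hom (Z ⊕ X) Z) (g.comp (Hom.fst Z X))) (Hom.id (Z ⊕ X)))

/-! ### Explicit formulas

They serve to show that the interpretation of the differential λ-calculus is compatible with the
equations of its syntax. -/

section

variable {X : Type*} {Y : Type*} {Z : Type*} {W : Type*}

theorem truth_true {p : Prop} (h : p) : truth p = 0 := by simp [truth, h]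
theorem truth_false {p : Prop} (h : ¬ p) : truth p = ⊤ := by simp [truth, h]

theorem lefts_zero : lefts (0 : Multiset (X ⊕ Y)) = 0 := rfl
theorem rights_zero : rights (0 : Multiset (X ⊕ Y)) = 0 := rfl
theorem lefts_cons_inl (x : X) (χ : Multiset (X ⊕ Y)) : lefts (Sum.inl x ::ₘ χ) = x ::ₘ lefts χ :=
  Multiset.filterMap_cons_some _ _ _ rfl
theorem lefts_cons_inr (x : Y) (χ : Multiset (X ⊕ Y)) : lefts (Sum.inr x ::ₘ χ) = lefts χ :=
  Multiset.filterMap_cons_none _ _ rfl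
theorem rights_cons_inr (x : Y) (χ : Multiset (X ⊕ Y)) : rights (Sum.inr x ::ₘ χ) = x ::ₘ rights χ :=
  Multiset.filterMap_cons_some _ _ _ rfl
theorem rights_cons_inl (x : X) (χ : Multiset (X ⊕ Y)) : rights (Sum.inl x ::ₘ χ) = rights χ :=
  Multiset.filterMap_cons_none _ _ rfl
theorem lefts_oplus (μ : Multiset X) (ρ : Multiset Y) : lefts (oplus μ ρ) = μ := by
  induction μ using Multiset.induction with
  | empty =>
    induction ρ using Multiset.induction with
    | empty => rfl
    | cons a s ih => simpa [oplus, lefts_cons_inr] using ih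
  | cons a s ih => simpa [oplus, lefts_cons_inl] using ih
theorem rights_oplus (μ : Multiset X) (ρ : Multiset Y) : rights (oplus μ ρ) = ρ := by
  induction μ using Multiset.induction with
  | empty =>
    induction ρ using Multiset.induction with
    | empty => rfl
    | cons a s ih => simpa [oplus, rights_cons_inr] using ih
  | cons a s ih => simpa [oplus, rights_cons_inl] using ih
theorem oplus_lefts_rights (χ : Multiset (X ⊕ Y)) : oplus (lefts χ) (rights χ) = χ := by
  induction χ using Multiset.induction with
  | empty => simp [oplus, lefts, rights]
  | cons a s ih =>
    rcases a with a | a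
    · simpa [oplus, lefts_cons_inl, rights_cons_inl] using ih
    · simpa [oplus, lefts_cons_inr, rights_cons_inr] using ih

theorem lift_multiset {α β : Type*} (f : β → α) (s : Multiset α) (h : ∀ a ∈ s, ∃ b, f b = a) :
    ∃ d : Multiset β, d.map f = s := by
  induction s using Multiset.induction with
  | empty => exact ⟨0, rfl⟩
  | cons a s ih =>
    obtain ⟨b, rfl⟩ := h a (by simp)
    obtain ⟨d, rfl⟩ := ih fun a ha => h a (by simp [ha])
    exact ⟨b ::ₘ d, by simp⟩

theorem oplus_add (μ μ' : Multiset X) (ρ ρ' : Multiset Y) :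
    oplus (μ + μ') (ρ + ρ') = oplus μ ρ + oplus μ' ρ' := by
  simp only [oplus, Multiset.map_add]; abel

theorem comp_le (s : Hom Y Z) (t : Hom X Y) (γ : Multiset (Multiset X × Y)) (c : Z) :
    s.comp t (γ.map Prod.fst).sum c ≤ s (γ.map Prod.snd) c + (γ.map fun p => t p.1 p.2).sum := by
  unfold Hom.comp Mat.comp
  refine (iInf_le _ (γ.map Prod.snd)).trans ?_
  gcongr
  refine (iInf_le _ (γ.map Prod.fst)).trans ?_
  simp only [dig, truth_true, add_zero]
  exact iInf_le (fun γ' : {γ' : Multiset (Multiset X × Y) // γ'.map Prod.fst = γ.map Prod.fst ∧ γ'.map Prod.snd = γ.map Prod.snd} => (γ'.1.map fun p => t p.1 p.2).sum) ⟨γ, rfl, rfl⟩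

theorem le_comp (s : Hom Y Z) (t : Hom X Y) (μ : Multiset X) (c : Z) (r : ℝ≥0∞)
    (h : ∀ γ : Multiset (Multiset X × Y), (γ.map Prod.fst).sum = μ →
      r ≤ s (γ.map Prod.snd) c + (γ.map fun p => t p.1 p.2).sum) : r ≤ s.comp t μ c := by
  unfold Hom.comp Mat.comp
  refine le_iInf fun ν => ?_
  rw [ENNReal.add_iInf]
  refine le_iInf fun B => ?_
  by_cases hB : μ = B.sum
  · simp only [dig, truth_true hB, add_zero, Mat.bang]
    rw [ENNReal.add_iInf]
    refine le_iInf fun ⟨γ, h1, h2⟩ => ?_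
    subst h1 h2
    exact h γ hB.symm
  · simp [dig, truth_false hB]

/-- The explicit form of `ev ∘! ⟨f, g⟩`. -/
def appExplicit (f : Hom Z (Multiset X × Y)) (g : Hom Z X) (χ : Multiset Z) (y : Y) : ℝ≥0∞ :=
  ⨅ (p : {p : Multiset Z × Multiset (Multiset Z × X) // p.1 + (p.2.map Prod.fst).sum = χ}),
    f p.1.1 (p.1.2.map Prod.snd, y) + (p.1.2.map fun q => g q.1 q.2).sum

theorem ev_pair (f : Hom Z (Multiset X × Y)) (g : Hom Z X) :
    (Hom.ev X Y).comp (Hom.pair f g) = appExplicit f g := by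
  funext χ y
  apply le_antisymm
  · refine le_iInf fun ⟨⟨χ', γ⟩, h⟩ => ?_
    dsimp only at h ⊢
    subst h
    have := comp_le (Hom.ev X Y) (Hom.pair f g)
      ((χ', Sum.inl (γ.map Prod.snd, y)) ::ₘ γ.map fun q => (q.1, Sum.inr q.2)) y
    simp only [Multiset.map_cons, Multiset.map_map, Multiset.sum_cons, Function.comp_def] at this
    refine this.trans ?_
    rw [show Hom.ev X Y _ y = 0 from truth_true ⟨γ.map Prod.snd, by simp [oplus]⟩]
    simp [Hom.pair]
  · apply le_comp
    intro γ hγ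
    by_cases h : ∃ ρ : Multiset X, γ.map Prod.snd = oplus {(ρ, y)} ρ
    · obtain ⟨ρ, h⟩ := h
      have hm : (Sum.inl (ρ, y) : (Multiset X × Y) ⊕ X) ∈ γ.map Prod.snd := by simp [h, oplus]
      obtain ⟨⟨χ', a⟩, ha, haeq⟩ := Multiset.mem_map.1 hm
      dsimp at haeq; subst haeq
      obtain ⟨γ', rfl⟩ := Multiset.exists_cons_of_mem ha
      have h' : γ'.map Prod.snd = ρ.map Sum.inr := by simpa [oplus] using h
      obtain ⟨δ, rfl⟩ : ∃ δ : Multiset (Multiset Z × X), γ' = δ.map fun q => (q.1, Sum.inr q.2) := by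
        have : ∀ q ∈ γ', ∃ q' : Multiset Z × X, (q'.1, Sum.inr q'.2) = q := by
          intro q hq
          have : q.2 ∈ γ'.map Prod.snd := Multiset.mem_map_of_mem _ hq
          rw [h'] at this
          obtain ⟨x, _, hx⟩ := Multiset.mem_map.1 this
          exact ⟨(q.1, x), by simp [hx]⟩
        obtain ⟨d, hd⟩ := lift_multiset _ _ this
        exact ⟨d, hd.symm⟩
      have hρ : δ.map Prod.snd = ρ := by
        have : (δ.map Prod.snd).map (Sum.inr : X → (Multiset X × Y) ⊕ X) = ρ.map Sum.inr := by
          rw [← h']; simp [Multiset.map_map]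
        exact Multiset.map_injective Sum.inr_injective this
      subst hρ
      refine (iInf_le _ ⟨(χ', δ), by simpa [Multiset.map_map, Function.comp_def] using hγ⟩).trans ?_
      simp [Hom.pair, Multiset.map_map, Function.comp_def]
    · rw [show Hom.ev X Y _ y = ⊤ from truth_false h]; simp

theorem sum_eq_top {α : Type*} (s : Multiset α) (f : α → ℝ≥0∞) (a : α) (ha : a ∈ s) (h : f a = ⊤) :
    (s.map f).sum = ⊤ := by
  obtain ⟨t, rfl⟩ := Multiset.exists_cons_of_mem ha
  simp [h]

theorem sum_truth {α : Type*} (s : Multiset α) (p : α → Prop) :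
    (s.map fun a => truth (p a)).sum = truth (∀ a ∈ s, p a) := by
  induction s using Multiset.induction with
  | empty => simp [truth]
  | cons a s ih =>
    simp only [Multiset.map_cons, Multiset.sum_cons, ih, Multiset.forall_mem_cons]
    by_cases h : p a
    · by_cases h' : ∀ a ∈ s, p a
      · rw [truth_true h, truth_true h', truth_true ⟨h, h'⟩, zero_add]
      · rw [truth_true h, truth_false h', truth_false fun e => h' e.2, zero_add]
    · rw [truth_false h, truth_false (p := p a ∧ _) fun e => h e.1, top_add]

theorem sum_singletons {α β : Type*} (s : Multiset α) (f : α → β) :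
    (s.map fun a => ({f a} : Multiset β)).sum = s.map f := by
  induction s using Multiset.induction with
  | empty => simp
  | cons a s ih => simp [ih]

theorem comp_fst (f : Hom Z W) (χ : Multiset (Z ⊕ X)) (w : W) :
    f.comp (Hom.fst Z X) χ w = truth (rights χ = 0) + f (lefts χ) w := by
  apply le_antisymm
  · by_cases h : rights χ = 0
    · rw [truth_true h, zero_add]
      have := comp_le f (Hom.fst Z X) ((lefts χ).map fun z => ({Sum.inl z}, z)) w
      simp only [Multiset.map_map, Function.comp_def, Hom.fst, sum_singletons, sum_truth] at this
      rw [truth_true (by simp)] at this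
      have h2 := oplus_lefts_rights χ
      simp only [h, oplus, Multiset.map_zero, add_zero] at h2
      simpa [h2] using this
    · simp [truth_false h]
  · apply le_comp
    intro γ hγ
    simp only [Hom.fst, sum_truth]
    by_cases h : ∀ a ∈ γ, a.1 = {Sum.inl a.2}
    · rw [truth_true h, add_zero]
      have : χ = (γ.map Prod.snd).map Sum.inl := by
        rw [← hγ, Multiset.map_congr rfl h, sum_singletons, Multiset.map_map]; rfl
      have h2 : χ = oplus (γ.map Prod.snd) 0 := by simpa [oplus] using this
      rw [h2, rights_oplus, lefts_oplus, truth_true rfl, zero_add]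
    · rw [truth_false h, add_top]; exact le_top

theorem uncurry_apply (f : Hom Z (Multiset X × Y)) (ρ : Multiset Z) (μ : Multiset X) (y : Y) :
    f.uncurry (oplus ρ μ) y = f ρ (μ, y) := by
  rw [Hom.uncurry, ev_pair]
  apply le_antisymm
  · refine (iInf_le _ ⟨(oplus ρ 0, μ.map fun x => ({Sum.inr x}, x)), by
      simp only [Multiset.map_map, Function.comp_def]; rw [sum_singletons]; simp [oplus]⟩).trans ?_
    · simp only [Multiset.map_map, Function.comp_def, Hom.snd, sum_truth, comp_fst, rights_oplus, lefts_oplus]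
      rw [truth_true trivial, truth_true (by simp)]; simp
  · refine le_iInf fun ⟨⟨χ', γ⟩, h⟩ => ?_
    dsimp only at h ⊢
    simp only [Hom.snd, sum_truth, comp_fst]
    by_cases h1 : ∀ a ∈ γ, a.1 = {Sum.inr a.2}
    · by_cases h2 : rights χ' = 0
      · rw [truth_true h1, truth_true h2]
        rw [Multiset.map_congr rfl h1, sum_singletons] at h
        have h3 : oplus (lefts χ') (γ.map Prod.snd) = oplus ρ μ := by
          rw [← h]; nth_rewrite 2 [← oplus_lefts_rights χ']
          rw [h2]; simp [oplus, Multiset.map_map]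
        have a1 := congrArg lefts h3
        have a2 := congrArg rights h3
        simp only [lefts_oplus, rights_oplus] at a1 a2
        rw [a1, a2]; simp
      · simp [truth_false h2]
    · rw [truth_false h1, add_top]; exact le_top

/-- The explicit form of `Λ ((Λ⁻ f) ⋆ g)`. -/
def starExplicit (f : Hom Z (Multiset X × Y)) (g : Hom Z X) : Hom Z (Multiset X × Y) := fun ρ p =>
  ⨅ (q : {q : Multiset Z × Multiset Z × X // q.1 + q.2.1 = ρ}),
    g q.1.1 q.1.2.2 + f q.1.2.1 (q.1.2.2 ::ₘ p.1, p.2)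

theorem star_apply (f : Hom Z (Multiset X × Y)) (g : Hom Z X) :
    Hom.curry (f.uncurry.star g) = starExplicit f g := by
  funext ρ ⟨μ, y⟩
  simp only [Hom.curry]
  apply le_antisymm
  · refine le_iInf fun ⟨⟨ρ', ρ'', x⟩, h⟩ => ?_
    dsimp only at h ⊢
    subst h
    have := comp_le f.uncurry.diff (Hom.pair (Hom.pair (⊤ : Hom (Z ⊕ X) Z) (g.comp (Hom.fst Z X))) (Hom.id (Z ⊕ X))) ((oplus ρ' 0, Sum.inl (Sum.inr x)) ::ₘ (oplus ρ'' μ).map fun w => ({w}, Sum.inr w)) y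
    have e : (Multiset.map Prod.snd ((oplus ρ' 0, (Sum.inl (Sum.inr x) : (Z ⊕ X) ⊕ (Z ⊕ X))) ::ₘ (oplus ρ'' μ).map fun w => (({w} : Multiset (Z ⊕ X)), Sum.inr w))) = oplus {Sum.inr x} (oplus ρ'' μ) := by
      simp [oplus, Multiset.map_map]
    rw [e] at this
    simp only [Multiset.map_cons, Multiset.map_map, Multiset.sum_cons, Function.comp_def, Hom.pair, Sum.elim_inl, Sum.elim_inr, Hom.id, der, sum_truth, comp_fst, rights_oplus, lefts_oplus, Hom.diff] at this
    rw [truth_true trivial, truth_true (by simp), sum_singletons, Multiset.card_singleton, if_pos rfl] at this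
    rw [Hom.star]
    have e2 : oplus ρ'' μ + {Sum.inr x} = oplus ρ'' (x ::ₘ μ) := by
      simp [oplus]; rw [add_comm, Multiset.singleton_add]
    rw [e2, uncurry_apply] at this
    rw [Multiset.map_id'] at this
    have e3 : oplus ρ' 0 + (oplus ρ'' μ) = oplus (ρ' + ρ'') μ := by
      simp [oplus, add_assoc]
    rw [e3] at this
    refine this.trans (le_of_eq ?_)
    simp [add_comm]
  · rw [Hom.star]
    apply le_comp
    intro γ hγ
    unfold Hom.diff
    split_ifs with hc
    · obtain ⟨w, hw⟩ := Multiset.card_eq_one.1 hc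
      have hs := oplus_lefts_rights (γ.map Prod.snd)
      rw [hw] at hs
      have hm : (Sum.inl w : (Z ⊕ X) ⊕ (Z ⊕ X)) ∈ γ.map Prod.snd := by rw [← hs]; simp [oplus]
      obtain ⟨⟨χ', a⟩, ha, haeq⟩ := Multiset.mem_map.1 hm
      dsimp at haeq; subst haeq
      obtain ⟨γ', rfl⟩ := Multiset.exists_cons_of_mem ha
      rw [hw]
      generalize hr : rights (Multiset.map Prod.snd ((χ', Sum.inl w) ::ₘ γ')) = R at *
      have h' : γ'.map Prod.snd = R.map Sum.inr := by
        have := hs.symm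
        simpa [oplus] using this
      rcases w with z | x
      · simp [Hom.pair]
      simp only [Multiset.map_cons, Multiset.sum_cons, Hom.pair, Sum.elim_inl, Sum.elim_inr, comp_fst]
      by_cases h1 : rights χ' = 0
      swap
      · simp [truth_false h1]
      by_cases h2 : ∀ q ∈ γ', ∃ w', q = ({w'}, Sum.inr w')
      · have : γ' = R.map fun w => ({w}, Sum.inr w) := by
          obtain ⟨d, hd⟩ := lift_multiset (fun w : Z ⊕ X => (({w} : Multiset (Z ⊕ X)), (Sum.inr w : (Z ⊕ X) ⊕ (Z ⊕ X)))) γ' (fun q hq => by obtain ⟨w, h⟩ := h2 q hq; exact ⟨w, h.symm⟩)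
          rw [← hd] at h' ⊢
          congr 1
          apply Multiset.map_injective (Sum.inr_injective (α := Z ⊕ X))
          rw [← h']; simp [Multiset.map_map]
        subst this
        simp only [Multiset.map_cons, Multiset.map_map, Multiset.sum_cons, Function.comp_def] at hγ ⊢
        simp only [Sum.elim_inr, Hom.id, der, sum_truth]
        rw [truth_true h1, truth_true (by simp)]
        rw [sum_singletons, Multiset.map_id', ← oplus_lefts_rights R, ← oplus_lefts_rights χ', h1, ← oplus_add] at hγ
        have a1 := congrArg lefts hγ
        have a2 := congrArg rights hγ
        simp only [lefts_oplus, rights_oplus, zero_add] at a1 a2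
        have e2 : R + {Sum.inr x} = oplus (lefts R) (x ::ₘ μ) := by
          rw [← a2]; nth_rewrite 1 [← oplus_lefts_rights R]
          simp [oplus]; rw [add_comm, Multiset.singleton_add]
        rw [e2, uncurry_apply]
        refine (iInf_le _ ⟨(lefts χ', lefts R, x), a1⟩).trans ?_
        simp [add_comm]
      · push Not at h2
        obtain ⟨q, hq, hq'⟩ := h2
        have hq2 : q.2 ∈ γ'.map Prod.snd := Multiset.mem_map_of_mem _ hq
        rw [h'] at hq2
        obtain ⟨w, _, hw⟩ := Multiset.mem_map.1 hq2
        have : (γ'.map fun p => Sum.elim (Sum.elim ((⊤ : Hom (Z ⊕ X) Z) p.1) (g.comp (Hom.fst Z X) p.1)) (Hom.id (Z ⊕ X) p.1) p.2).sum = ⊤ := by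
          apply sum_eq_top _ _ q hq
          rw [← hw]
          apply truth_false
          intro h
          exact hq' w (Prod.ext h hw.symm)
        rw [this]; simp
    · simp

theorem starExplicit_comm (f : Hom Z (Multiset X × Y)) (g h : Hom Z X) : starExplicit (starExplicit f g) h = starExplicit (starExplicit f h) g := by
  have key : ∀ g h : Hom Z X, starExplicit (starExplicit f g) h ≤ starExplicit (starExplicit f h) g := by
    intro g h ρ p
    refine le_iInf fun ⟨⟨a, b, x⟩, e⟩ => ?_
    dsimp only at e ⊢
    unfold starExplicit
    rw [ENNReal.add_iInf]
    refine le_iInf fun ⟨⟨c, d, x'⟩, e'⟩ => ?_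
    dsimp only at e' ⊢
    refine (iInf_le _ ⟨(c, a + d, x'), by subst e'; dsimp only; rw [← e]; abel⟩).trans ?_
    dsimp only
    rw [← add_assoc, add_comm (g a x), add_assoc]
    gcongr
    refine (iInf_le _ ⟨(a, d, x), rfl⟩).trans ?_
    dsimp only
    rw [Multiset.cons_swap]
  exact le_antisymm (key g h) (key h g)

theorem appExplicit_inf (f f' : Hom Z (Multiset X × Y)) (g : Hom Z X) :
    appExplicit (f ⊓ f') g = appExplicit f g ⊓ appExplicit f' g := by
  funext χ y
  simp only [appExplicit, Pi.inf_apply, ← iInf_inf_eq]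
  exact iInf_congr fun p => min_add_add_right _ _ _ |>.symm

theorem appExplicit_top_left (g : Hom Z X) :
    appExplicit (⊤ : Hom Z (Multiset X × Y)) g = ⊤ := by
  funext χ y
  simp [appExplicit]

theorem starExplicit_inf_left (f f' : Hom Z (Multiset X × Y)) (g : Hom Z X) :
    starExplicit (f ⊓ f') g = starExplicit f g ⊓ starExplicit f' g := by
  funext χ y
  simp only [starExplicit, Pi.inf_apply, ← iInf_inf_eq]
  exact iInf_congr fun p => min_add_add_left _ _ _ |>.symm

theorem starExplicit_top_left (g : Hom Z X) :
    starExplicit (⊤ : Hom Z (Multiset X × Y)) g = ⊤ := by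
  funext χ y
  simp [starExplicit]

theorem starExplicit_inf_right (f : Hom Z (Multiset X × Y)) (g g' : Hom Z X) :
    starExplicit f (g ⊓ g') = starExplicit f g ⊓ starExplicit f g' := by
  funext χ y
  simp only [starExplicit, Pi.inf_apply, ← iInf_inf_eq]
  exact iInf_congr fun p => min_add_add_right _ _ _ |>.symm

theorem starExplicit_top_right (f : Hom Z (Multiset X × Y)) :
    starExplicit f (⊤ : Hom Z X) = ⊤ := by
  funext χ y
  simp [starExplicit]

end

/-! ### Simple types and typed terms

Terms are taken up to renaming of bound variables, and are represented by their typing derivations,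
with de Bruijn indices for variables. -/

/-- Simple types over a set `ι` of ground types. -/
inductive Ty (ι : Type u) : Type u
  | ground : ι → Ty ι
  | arr : Ty ι → Ty ι → Ty ι

/-- `Var Γ A` is the set of the variables declared with type `A` in the context `Γ`. The most
recent declaration is the head of the list. -/
inductive Var {ι : Type u} : List (Ty ι) → Ty ι → Type u
  | zero {Γ : List (Ty ι)} {A : Ty ι} : Var (A :: Γ) A
  | succ {Γ : List (Ty ι)} {A B : Ty ι} : Var Γ A → Var (B :: Γ) A

/-- Simply typed λ-terms `Γ ⊢ M : A`. -/
inductive Tm {ι : Type u} : List (Ty ι) → Ty ι → Type u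
  | var {Γ : List (Ty ι)} {A : Ty ι} : Var Γ A → Tm Γ A
  | lam {Γ : List (Ty ι)} {A B : Ty ι} : Tm (A :: Γ) B → Tm Γ (Ty.arr A B)
  | app {Γ : List (Ty ι)} {A B : Ty ι} : Tm Γ (Ty.arr A B) → Tm Γ A → Tm Γ B

/-! ### Syntax of the simply typed differential λ-calculus

Sums are allowed in every position, and expressions are then identified by the equations `RawEq`; by
linearity, every expression is equal to a finite sum of terms `M ::= x | λx.M | M T | D[M, M]`,
where `T` is a sum. -/

/-- Typed expressions of the differential λ-calculus, before the quotient. -/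
inductive Raw {ι : Type u} : List (Ty ι) → Ty ι → Type u
  | var {Γ : List (Ty ι)} {A : Ty ι} : Var Γ A → Raw Γ A
  | lam {Γ : List (Ty ι)} {A B : Ty ι} : Raw (A :: Γ) B → Raw Γ (Ty.arr A B)
  | app {Γ : List (Ty ι)} {A B : Ty ι} : Raw Γ (Ty.arr A B) → Raw Γ A → Raw Γ B
  | diff {Γ : List (Ty ι)} {A B : Ty ι} : Raw Γ (Ty.arr A B) → Raw Γ A → Raw Γ (Ty.arr A B)
  | zero {Γ : List (Ty ι)} {A : Ty ι} : Raw Γ A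
  | add {Γ : List (Ty ι)} {A : Ty ι} : Raw Γ A → Raw Γ A → Raw Γ A

/-- The equations between expressions, applied in an arbitrary context: `+` and `0` form an
idempotent commutative monoid; `λx.(_)`, `D[_, _]` (in both arguments) and `(_) T` are linear, but
`M (_)` is not; the order of consecutive `D[_, _]` is irrelevant. -/
inductive RawEq {ι : Type u} : {Γ : List (Ty ι)} → {A : Ty ι} → Raw Γ A → Raw Γ A → Prop
  | add_comm {Γ : List (Ty ι)} {A : Ty ι} (M N : Raw Γ A) : RawEq (M.add N) (N.add M)
  | add_assoc {Γ : List (Ty ι)} {A : Ty ι} (M N P : Raw Γ A) :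
      RawEq ((M.add N).add P) (M.add (N.add P))
  | add_zero {Γ : List (Ty ι)} {A : Ty ι} (M : Raw Γ A) : RawEq (M.add Raw.zero) M
  | add_idem {Γ : List (Ty ι)} {A : Ty ι} (M : Raw Γ A) : RawEq (M.add M) M
  | lam_add {Γ : List (Ty ι)} {A B : Ty ι} (M N : Raw (A :: Γ) B) :
      RawEq (M.add N).lam (M.lam.add N.lam)
  | lam_zero {Γ : List (Ty ι)} {A B : Ty ι} :
      RawEq (Raw.zero : Raw (A :: Γ) B).lam Raw.zero
  | app_add {Γ : List (Ty ι)} {A B : Ty ι} (M N : Raw Γ (Ty.arr A B)) (T : Raw Γ A) :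
      RawEq ((M.add N).app T) ((M.app T).add (N.app T))
  | app_zero {Γ : List (Ty ι)} {A B : Ty ι} (T : Raw Γ A) :
      RawEq ((Raw.zero : Raw Γ (Ty.arr A B)).app T) Raw.zero
  | diff_add_left {Γ : List (Ty ι)} {A B : Ty ι} (M N : Raw Γ (Ty.arr A B)) (P : Raw Γ A) :
      RawEq ((M.add N).diff P) ((M.diff P).add (N.diff P))
  | diff_zero_left {Γ : List (Ty ι)} {A B : Ty ι} (P : Raw Γ A) :
      RawEq ((Raw.zero : Raw Γ (Ty.arr A B)).diff P) Raw.zero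
  | diff_add_right {Γ : List (Ty ι)} {A B : Ty ι} (M : Raw Γ (Ty.arr A B)) (P Q : Raw Γ A) :
      RawEq (M.diff (P.add Q)) ((M.diff P).add (M.diff Q))
  | diff_zero_right {Γ : List (Ty ι)} {A B : Ty ι} (M : Raw Γ (Ty.arr A B)) :
      RawEq (M.diff Raw.zero) Raw.zero
  | diff_swap {Γ : List (Ty ι)} {A B : Ty ι} (M : Raw Γ (Ty.arr A B)) (P Q : Raw Γ A) :
      RawEq ((M.diff P).diff Q) ((M.diff Q).diff P)
  | lam_congr {Γ : List (Ty ι)} {A B : Ty ι} {M N : Raw (A :: Γ) B} :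
      RawEq M N → RawEq M.lam N.lam
  | app_congr_left {Γ : List (Ty ι)} {A B : Ty ι} {M N : Raw Γ (Ty.arr A B)} (T : Raw Γ A) :
      RawEq M N → RawEq (M.app T) (N.app T)
  | app_congr_right {Γ : List (Ty ι)} {A B : Ty ι} (M : Raw Γ (Ty.arr A B)) {T T' : Raw Γ A} :
      RawEq T T' → RawEq (M.app T) (M.app T')
  | diff_congr_left {Γ : List (Ty ι)} {A B : Ty ι} {M N : Raw Γ (Ty.arr A B)} (P : Raw Γ A) :
      RawEq M N → RawEq (M.diff P) (N.diff P)
  | diff_congr_right {Γ : List (Ty ι)} {A B : Ty ι} (M : Raw Γ (Ty.arr A B)) {P Q : Raw Γ A} :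
      RawEq P Q → RawEq (M.diff P) (M.diff Q)
  | add_congr_left {Γ : List (Ty ι)} {A : Ty ι} {M N : Raw Γ A} (P : Raw Γ A) :
      RawEq M N → RawEq (M.add P) (N.add P)
  | add_congr_right {Γ : List (Ty ι)} {A : Ty ι} (M : Raw Γ A) {P Q : Raw Γ A} :
      RawEq P Q → RawEq (M.add P) (M.add Q)

/-- Expressions `Γ ⊢ t : A` of the simply typed differential λ-calculus: the quotient by the
equivalence relation generated by `RawEq`. -/
def DTm {ι : Type u} (Γ : List (Ty ι)) (A : Ty ι) : Type u := Quot (RawEq (Γ := Γ) (A := A))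

section

variable {ι : Type u} {Γ : List (Ty ι)} {A B : Ty ι}

/-- A variable. -/
def DTm.var (x : Var Γ A) : DTm Γ A := Quot.mk _ (Raw.var x)

/-- Abstraction `λx.t`. -/
def DTm.lam : DTm (A :: Γ) B → DTm Γ (Ty.arr A B) :=
  Quot.map Raw.lam fun _ _ h => RawEq.lam_congr h

/-- Application `t T`. -/
def DTm.app : DTm Γ (Ty.arr A B) → DTm Γ A → DTm Γ B :=
  Quot.map₂ Raw.app (fun M _ _ h => RawEq.app_congr_right M h)
    (fun _ _ T h => RawEq.app_congr_left T h)

/-- Differential application `D[t, u]`. -/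
def DTm.diff : DTm Γ (Ty.arr A B) → DTm Γ A → DTm Γ (Ty.arr A B) :=
  Quot.map₂ Raw.diff (fun M _ _ h => RawEq.diff_congr_right M h)
    (fun _ _ P h => RawEq.diff_congr_left P h)

/-- The empty sum `0`. -/
def DTm.zero : DTm Γ A := Quot.mk _ Raw.zero

end

/-! ### Interpretation -/

/-- Interpretation of types, for a given interpretation `G` of the ground types. -/
@[reducible]
def Ty.interp {ι : Type u} (G : ι → Type v) : Ty ι → Type v
  | Ty.ground i => G i
  | Ty.arr A B => Multiset (Ty.interp G A) × Ty.interp G B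

/-- Interpretation of contexts: the product of the interpretations of the declared types. -/
@[reducible]
def ctxInterp {ι : Type u} (G : ι → Type v) : List (Ty ι) → Type v
  | [] => PEmpty
  | A :: Γ => ctxInterp G Γ ⊕ Ty.interp G A

/-- Interpretation of variables as projections. -/
def Var.interp {ι : Type u} (G : ι → Type v) : {Γ : List (Ty ι)} → {A : Ty ι} → Var Γ A →
    Hom (ctxInterp G Γ) (Ty.interp G A)
  | _, _, @Var.zero _ Γ A => Hom.snd (ctxInterp G Γ) (Ty.interp G A)
  | _, _, @Var.succ _ Γ _ B x =>
      (Var.interp G x).comp (Hom.fst (ctxInterp G Γ) (Ty.interp G B))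

/-- Interpretation of simply typed λ-terms. -/
def Tm.interp {ι : Type u} (G : ι → Type v) : {Γ : List (Ty ι)} → {A : Ty ι} → Tm Γ A →
    Hom (ctxInterp G Γ) (Ty.interp G A)
  | _, _, Tm.var x => Var.interp G x
  | _, _, Tm.lam M => Hom.curry (Tm.interp G M)
  | _, _, @Tm.app _ _ A B M N =>
      (Hom.ev (Ty.interp G A) (Ty.interp G B)).comp
        (Hom.pair (Tm.interp G M) (Tm.interp G N))

/-- Interpretation of expressions of the differential λ-calculus, before the quotient: `0` is the
matrix `∞`, and `+` is the pointwise minimum. -/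
def Raw.interp {ι : Type u} (G : ι → Type v) : {Γ : List (Ty ι)} → {A : Ty ι} → Raw Γ A →
    Hom (ctxInterp G Γ) (Ty.interp G A)
  | _, _, Raw.var x => Var.interp G x
  | _, _, Raw.lam M => Hom.curry (Raw.interp G M)
  | _, _, @Raw.app _ _ A B M T =>
      (Hom.ev (Ty.interp G A) (Ty.interp G B)).comp
        (Hom.pair (Raw.interp G M) (Raw.interp G T))
  | _, _, Raw.diff M N => Hom.curry ((Hom.uncurry (Raw.interp G M)).star (Raw.interp G N))
  | _, _, Raw.zero => ⊤
  | _, _, Raw.add M N => Raw.interp G M ⊓ Raw.interp G N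

/-- The interpretation is compatible with the equations. -/
theorem RawEq.interp_eq {ι : Type u} (G : ι → Type v) {Γ : List (Ty ι)} {A : Ty ι} {M N : Raw Γ A}
    (h : RawEq M N) : M.interp G = N.interp G := by
  induction h with
  | add_comm M N => exact inf_comm _ _
  | add_assoc M N P => exact inf_assoc _ _ _
  | add_zero M => exact inf_top_eq _
  | add_idem M => exact inf_idem _
  | lam_add M N => rfl
  | lam_zero => rfl
  | app_add M N T => simp only [Raw.interp, ev_pair, appExplicit_inf]
  | app_zero T => simp only [Raw.interp, ev_pair, appExplicit_top_left]
  | diff_add_left M N P => simp only [Raw.interp, star_apply, starExplicit_inf_left]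
  | diff_zero_left P => simp only [Raw.interp, star_apply, starExplicit_top_left]
  | diff_add_right M P Q => simp only [Raw.interp, star_apply, starExplicit_inf_right]
  | diff_zero_right M => simp only [Raw.interp, star_apply, starExplicit_top_right]
  | diff_swap M P Q =>
    simp only [Raw.interp, star_apply]
    exact starExplicit_comm _ _ _
  | lam_congr _ ih => simp only [Raw.interp, ih]
  | app_congr_left T _ ih => simp only [Raw.interp, ih]
  | app_congr_right M _ ih => simp only [Raw.interp, ih]
  | diff_congr_left P _ ih => simp only [Raw.interp, ih]
  | diff_congr_right M _ ih => simp only [Raw.interp, ih]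
  | add_congr_left P _ ih => simp only [Raw.interp, ih]
  | add_congr_right M _ ih => simp only [Raw.interp, ih]

/-- Interpretation of the simply typed differential λ-calculus. -/
def DTm.interp {ι : Type u} (G : ι → Type v) {Γ : List (Ty ι)} {A : Ty ι} (t : DTm Γ A) :
    Hom (ctxInterp G Γ) (Ty.interp G A) :=
  Quot.lift (Raw.interp G) (fun _ _ h => RawEq.interp_eq G h) t

/-! ### Taylor expansion -/

/-- `t · ⟨u₁,…,uₖ⟩`, an abbreviation for `Dᵏ[t, u₁,…,uₖ] 0`, where
`Dᵏ[t, u₁,…,uₖ] = D[…D[D[t, u₁], u₂]…, uₖ]`. -/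
def DTm.resApp {ι : Type u} {Γ : List (Ty ι)} {A B : Ty ι} (t : DTm Γ (Ty.arr A B))
    (us : List (DTm Γ A)) : DTm Γ B :=
  DTm.app (us.foldl DTm.diff t) DTm.zero

/-- The Taylor expansion of a simply typed λ-term. -/
def Tm.taylor {ι : Type u} : {Γ : List (Ty ι)} → {A : Ty ι} → Tm Γ A → Set (DTm Γ A)
  | _, _, Tm.var x => {DTm.var x}
  | _, _, Tm.lam M => {r | ∃ t ∈ Tm.taylor M, r = DTm.lam t}
  | _, _, Tm.app M N =>
      {r | ∃ t ∈ Tm.taylor M, ∃ us : List (DTm _ _),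
        (∀ u ∈ us, u ∈ Tm.taylor N) ∧ r = DTm.resApp t us}

end TropLam

end

namespace TropLam

/-! ### Iterated differentials in matrix form. -/

section

variable {X : Type*} {Y : Type*} {Z : Type*} {α : Type*}

/-! The only real case is application. By `ev_pair`, the entry of `M N` at `(χ, y)` is the infimum,
over all splittings `χ = χ' + χ₁ + … + χₙ` and all points `x₁, …, xₙ`, of `⟦M⟧` at `(χ', ([x₁,…,xₙ],
y))` plus the sum of the `⟦N⟧` at `(χᵢ, xᵢ)`. The term `Dⁿ[t, u₁,…,uₙ] 0` computes the same infimum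
for this one `n`, with `t` in place of `M` and `uᵢ` in place of the `i`-th copy of `N`: each
differential feeds exactly one point to the function, and the final `0` forbids any further one.

By induction `⟦M⟧` and `⟦N⟧` are the infima over their expansions. Addition on `[0,∞]` distributes
over arbitrary infima, empty ones included, so a different `uᵢ` can be chosen for each copy of `N`;
taking the infimum over `n`, `t` and the `uᵢ` then gives back the entry of `M N`. The two
inequalities are carried by `le_foldl_starExplicit` and `le_add_sum_of_le_foldl_starExplicit`, which
argue by induction and never write the iterated differential as one infimum over splittings. -/

/-- With `μ = 0` the hypothesis `h` says that `r` is at most the entry of `ev ∘! ⟨f, g⟩` at `(χ,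
y)`. It covers `γ` of every size, although only size `us.length` matters, so it passes from `f` to
`starExplicit f (k u)`. -/
theorem le_foldl_starExplicit {g : Hom Z X} (k : α → Hom Z X) (us : List α)
    (hus : ∀ u ∈ us, g ≤ k u) (f : Hom Z (Multiset X × Y)) (χ : Multiset Z) (μ : Multiset X)
    (y : Y) (r : ℝ≥0∞)
    (h : ∀ (χ' : Multiset Z) (γ : Multiset (Multiset Z × X)), χ' + (γ.map Prod.fst).sum = χ →
      r ≤ f χ' (γ.map Prod.snd + μ, y) + (γ.map fun q => g q.1 q.2).sum) :
    r ≤ us.foldl (fun f u => starExplicit f (k u)) f χ (μ, y) := by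
  induction us generalizing f with
  | nil => simpa using h χ 0 (by simp)
  | cons u us ih =>
    refine ih (fun v hv => hus v (List.mem_cons_of_mem _ hv)) _ fun χ' γ hγ => ?_
    simp only [starExplicit]
    rw [ENNReal.iInf_add]
    refine le_iInf fun ⟨⟨ρ, ρ', x⟩, hρ⟩ => ?_
    dsimp only at hρ ⊢
    subst hρ
    -- The share `ρ` and the point `x` consumed by the differential along `u` become one more pair
    -- of the splitting.
    refine (h ρ' ((ρ, x) ::ₘ γ) ?_).trans ?_
    · rw [← hγ, Multiset.map_cons, Multiset.sum_cons]; abel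
    · simp only [Multiset.map_cons, Multiset.sum_cons, Multiset.cons_add]
      rw [← add_assoc, add_comm (f _ _)]
      gcongr
      exact hus u List.mem_cons_self ρ x

/-- Here the splitting `γ` is fixed and each of its pairs picks its own `u ∈ T`; the picks form the
list `us`. This is distributivity of a finite sum over infima, done one pair at a time. -/
theorem le_add_sum_of_le_foldl_starExplicit (k : α → Hom Z X) (T : Set α) (μ : Multiset X)
    (y : Y) (r : ℝ≥0∞) (γ : Multiset (Multiset Z × X)) (f : Hom Z (Multiset X × Y))
    (χ : Multiset Z)
    (h : ∀ us : List α, (∀ u ∈ us, u ∈ T) →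
      r ≤ us.foldl (fun f u => starExplicit f (k u)) f (χ + (γ.map Prod.fst).sum) (μ, y)) :
    r ≤ f χ (γ.map Prod.snd + μ, y) + (γ.map fun q => (⨅ u ∈ T, k u) q.1 q.2).sum := by
  induction γ using Multiset.induction generalizing f χ with
  | empty => simpa using h [] (by simp)
  | cons q γ ih =>
    obtain ⟨ρ, x⟩ := q
    simp only [Multiset.map_cons, Multiset.sum_cons, Multiset.cons_add]
    rw [← add_assoc, add_comm (f _ _), add_assoc]
    rw [iInf_apply, iInf_apply]
    -- No nonemptiness of `T` is needed: an empty infimum is `∞`, which absorbs addition.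
    rw [ENNReal.iInf_add]
    refine le_iInf fun u => ?_
    rw [iInf_apply, iInf_apply, ENNReal.iInf_add]
    refine le_iInf fun hu => ?_
    -- The pair `(ρ, x)` is absorbed into the function, which therefore receives `ρ` as well as `χ`.
    refine (ih (starExplicit f (k u)) (ρ + χ) fun us hus => ?_).trans ?_
    · have := h (u :: us) (by simpa [hu] using hus)
      simpa only [Multiset.map_cons, Multiset.sum_cons, List.foldl_cons, ← add_assoc,
        add_comm ρ χ] using this
    · rw [← add_assoc]
      gcongr
      exact iInf_le (fun q : {q : Multiset Z × Multiset Z × X // q.1 + q.2.1 = ρ + χ} =>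
        k u q.1.1 q.1.2.2 + f q.1.2.1 (q.1.2.2 ::ₘ (γ.map Prod.snd + μ), y)) ⟨(ρ, χ, x), rfl⟩

/-- Every use of the argument costs `∞`, so only the splitting with no use of it survives. -/
theorem appExplicit_top_right (f : Hom Z (Multiset X × Y)) (χ : Multiset Z) (y : Y) :
    appExplicit f (⊤ : Hom Z X) χ y = f χ (0, y) := by
  apply le_antisymm
  · exact (iInf_le _ ⟨(χ, 0), by simp⟩).trans (by simp)
  · refine le_iInf fun ⟨⟨χ', γ⟩, h⟩ => ?_
    dsimp only at h ⊢
    rcases γ.empty_or_exists_mem with rfl | ⟨q, hq⟩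
    · simp at h; simp [h]
    · rw [sum_eq_top γ _ q hq rfl, add_top]; exact le_top

end

/-! ### Interpretation of the terms of a Taylor expansion. -/

section

variable {ι : Type u} (G : ι → Type v) {Γ : List (Ty ι)} {A B : Ty ι}

theorem DTm.interp_lam (t : DTm (A :: Γ) B) : t.lam.interp G = Hom.curry (t.interp G) := by
  induction t using Quot.ind; rfl

theorem DTm.interp_diff (t : DTm Γ (Ty.arr A B)) (u : DTm Γ A) :
    (t.diff u).interp G = starExplicit (t.interp G) (u.interp G) := by
  induction t using Quot.ind
  induction u using Quot.ind
  exact star_apply _ _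

theorem DTm.interp_foldl_diff (us : List (DTm Γ A)) (t : DTm Γ (Ty.arr A B)) :
    (us.foldl DTm.diff t).interp G =
      us.foldl (fun f u => starExplicit f (u.interp G)) (t.interp G) := by
  induction us generalizing t with
  | nil => rfl
  | cons u us ih => rw [List.foldl_cons, List.foldl_cons, ih, DTm.interp_diff]

theorem DTm.interp_resApp (t : DTm Γ (Ty.arr A B)) (us : List (DTm Γ A))
    (χ : Multiset (ctxInterp G Γ)) (y : Ty.interp G B) :
    (t.resApp us).interp G χ y =
      us.foldl (fun f u => starExplicit f (u.interp G)) (t.interp G) χ (0, y) := by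
  rw [← DTm.interp_foldl_diff, DTm.resApp]
  generalize us.foldl DTm.diff t = s
  induction s using Quot.ind
  -- Once `s` is a class of a raw expression, the application to `0` unfolds to `ev ∘! ⟨s, ∞⟩`.
  refine Eq.trans ?_ (appExplicit_top_right _ χ y)
  rw [← ev_pair]
  rfl

end

end TropLam

open TropLam

/-! ### The Taylor formula, by induction on the term. -/

theorem mainTheorem5 {ι : Type u} (G : ι → Type v) {Γ : List (TropLam.Ty ι)} {A : TropLam.Ty ι}
    (M : TropLam.Tm Γ A) :
    M.interp G = ⨅ t ∈ M.taylor, t.interp G := by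
  induction M with
  | var x => simp only [Tm.taylor, Tm.interp, Set.mem_singleton_iff, iInf_iInf_eq_left]; rfl
  | lam M ih =>
    funext χ p
    simp only [Tm.interp, Hom.curry, ih, iInf_apply]
    apply le_antisymm
    · refine le_iInf₂ ?_
      rintro _ ⟨t, ht, rfl⟩
      rw [DTm.interp_lam]
      exact iInf₂_le t ht
    · refine le_iInf₂ fun t ht => (iInf₂_le t.lam ⟨t, ht, rfl⟩).trans ?_
      rw [DTm.interp_lam]
      rfl
  | app M N ihM ihN =>
    funext χ y
    rw [Tm.interp, ev_pair]
    simp only [iInf_apply]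
    apply le_antisymm
    · refine le_iInf₂ ?_
      rintro _ ⟨t, ht, us, hus, rfl⟩
      rw [DTm.interp_resApp]
      -- Replacing `M` by `t` and each copy of `N` by some `u` only increases entries.
      refine le_foldl_starExplicit (g := N.interp G) _ us
        (fun u hu => ihN.trans_le (iInf₂_le u (hus u hu))) _ _ _ _ _ fun χ' γ hγ => ?_
      refine (iInf_le _ ⟨(χ', γ), hγ⟩).trans ?_
      dsimp only
      rw [add_zero]
      gcongr
      exact ihM.trans_le (iInf₂_le t ht) _ _
    · refine le_iInf fun ⟨⟨χ', γ⟩, h⟩ => ?_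
      dsimp only at h ⊢
      subst h
      rw [ihM, ihN]
      rw [iInf_apply, iInf_apply]
      rw [ENNReal.iInf_add]
      refine le_iInf fun t => ?_
      rw [iInf_apply, iInf_apply, ENNReal.iInf_add]
      refine le_iInf fun ht => ?_
      -- With `t` and the splitting fixed, `r` is the whole right-hand infimum: it bounds every
      -- `t.resApp us` from below, whatever the length of `us`.
      have := le_add_sum_of_le_foldl_starExplicit (fun u : DTm _ _ => u.interp G) N.taylor 0 y
        (⨅ r ∈ (M.app N).taylor, r.interp G (χ' + (γ.map Prod.fst).sum) y) γ (t.interp G) χ'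
        fun us hus => by
          rw [← DTm.interp_resApp]
          exact iInf₂_le (t.resApp us) ⟨t, ht, us, hus, rfl⟩
      rwa [add_zero] at this
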